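/- Let $k\ge 0$ and let $FA=GF_2\langle a_1,\dots,a_k\rangle$ be the free associative algebra over the field with two elements. The degree of an element of $FA$ is the maximal length of a monomial (a word in $a_1,\dots,a_k$) occurring in it, and its top homogeneous part is the sum of the monomials of this maximal length occurring in it. Let $u_1,u_2,v_1,v_2\in FA$ be such that the top homogeneous part of each of them is a single monomial with no periodicity, i.e. a monomial that contains no subword $\alpha^2$ with $\alpha$ a non-trivial word. Suppose that $\deg u_1>\deg v_1$ and that the equation $u_1xu_2=v_1xv_2$ has a solution $x\in FA$ of degree greater than $2(\deg u_1+\deg v_2)^2$. Then there are $s,t\in FA$ such that: (1) $u_1=v_1s$ and $v_2=tu_2$; (2) an element $x\in FA$ is a solution of $u_1xu_2=v_1xv_2$ if and only if it is a solution of $sx=xt$. -/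

import Mathlib

/-- The free associative algebra over the field with two elements on `k` free generators. -/
abbrev FA (k : ℕ) : Type := FreeAlgebra (ZMod 2) (Fin k)

namespace FA

/-- The monomial `a_{i₁} ⋯ a_{iₘ}` of the free associative algebra that is spelled by a word
(an element of the free monoid on the generators). The empty word gives `1`. -/
noncomputable def monomial {k : ℕ} (w : FreeMonoid (Fin k)) : FA k :=
  FreeMonoid.lift (FreeAlgebra.ι (ZMod 2)) w

/-- The coefficients of an element in the basis of monomials. -/
noncomputable def coeffs {k : ℕ} (p : FA k) : FreeMonoid (Fin k) →₀ ZMod 2 :=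
  (FreeAlgebra.equivMonoidAlgebraFreeMonoid p).coeff

/-- The degree: the maximal length of a monomial that occurs in `p` (and `0` for `p = 0`). -/
noncomputable def degree {k : ℕ} (p : FA k) : ℕ :=
  (coeffs p).support.sup FreeMonoid.length

/-- The homogeneous part of `p` of degree `n`: the part of `p` carried by the monomials of
length `n`. -/
noncomputable def homogeneousPart {k : ℕ} (n : ℕ) (p : FA k) : FA k :=
  ∑ w ∈ (coeffs p).support with w.length = n, coeffs p w • monomial w

/-- The top homogeneous part of `p`. -/
noncomputable def topPart {k : ℕ} (p : FA k) : FA k :=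
  homogeneousPart (degree p) p

/-- A word has no periodicity if it contains no subword `α ^ 2` with `α` non-trivial. -/
def Aperiodic {k : ℕ} (w : FreeMonoid (Fin k)) : Prop :=
  ∀ β α γ : FreeMonoid (Fin k), w = β * α ^ 2 * γ → α = 1

/-- The top homogeneous part of `p` is a single monomial, and this monomial has no periodicity. -/
def HasAperiodicMonomialTop {k : ℕ} (p : FA k) : Prop :=
  ∃ w : FreeMonoid (Fin k), topPart p = monomial w ∧ Aperiodic w

end FA

/-!
Call a word of maximal length among those occurring in `p` a *top word* of `p`. In a free algebra
over a field the top words of a product are exactly the products of the top words of its factors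
(`FA.IsTopWord.mul`, `FA.IsTopWord.exists_of_mul`).

Let `a` and `b` be the unique top words of `u₁` and `v₁`. Comparing prefixes of top words in
`u₁ x u₂ = v₁ x v₂` gives `a = b c` with `c` non-trivial. Divide `u₁` by `v₁` on the left:
`u₁ = v₁ s + r`, where no word of `r` begins with `b` (`FA.exists_eq_mul_add`). Then
`r x u₂ = v₁ (x v₂ - s x u₂)`. If `r ≠ 0`, compare top words again. A top word `R` of `r` cannot
begin with `b`, so `b = R q` with `q` non-trivial, and `q` is a prefix of every top word of `x`,
as these are long. On the other hand each top word of `x` begins like `c` followed by another top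
word of `x`. Hence `q` is a prefix of `c q`, that is, `q` is a prefix of a power of `c`, which
forces a square into `q c` (`FA.exists_square_of_dvd_mul`), a suffix of `a = R q c`. As `a` has no
periodicity, `r = 0` and `u₁ = v₁ s` (`FA.exists_eq_mul_of_equation`).

Reversal of words, the star operation of the free algebra, turns the equation into
`v₂* x* v₁* = u₂* x* u₁*`, so the same argument gives `v₂ = t u₂`. As the free algebra is a domain,
`v₁` and `u₂` can then be cancelled from `v₁ s x u₂ = v₁ x t u₂`.

The only use of the bound on the degree of `x` is that it exceeds `deg v₁` and `deg u₂`.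
-/

namespace FA

variable {k : ℕ}

/-! ### Prefixes and squares in words

Divisibility `a ∣ w` in the free monoid is the prefix relation. -/

theorem dvd_of_mul_eq_mul {α : Type*} {a b c d : FreeMonoid α} (h : a * b = c * d)
    (hl : a.length ≤ c.length) : a ∣ c := by
  rcases List.append_eq_append_iff.1 h with ⟨e, he, -⟩ | ⟨e, he, -⟩
  · exact ⟨e, he⟩
  · replace he : a = c * (FreeMonoid.ofList e) := he
    have h0 : FreeMonoid.ofList e = 1 := by
      rw [← FreeMonoid.length_eq_zero]
      rw [he, FreeMonoid.length_mul] at hl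
      omega
    exact ⟨1, by rw [he, h0, mul_one, mul_one]⟩

theorem dvd_of_dvd_of_dvd {α : Type*} {a c w : FreeMonoid α} (ha : a ∣ w) (hc : c ∣ w)
    (hl : a.length ≤ c.length) : a ∣ c := by
  obtain ⟨b, hb⟩ := ha
  obtain ⟨d, hd⟩ := hc
  exact dvd_of_mul_eq_mul (hb.symm.trans hd) hl

/-- The hypothesis `q ∣ c * q` says that `q` is a prefix of a power of `c`. -/
theorem exists_square_of_dvd_mul {α : Type*} {c : FreeMonoid α} (hc : c ≠ 1) (q : FreeMonoid α)
    (hq : q ≠ 1) (h : q ∣ c * q) :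
    ∃ β γ δ : FreeMonoid α, γ ≠ 1 ∧ q * c = β * γ ^ 2 * δ := by
  rcases le_total q.length c.length with hl | hl
  · obtain ⟨d, rfl⟩ := dvd_of_dvd_of_dvd h (dvd_mul_right c q) hl
    exact ⟨1, q, d, hq, by simp only [pow_two, one_mul, mul_assoc]⟩
  · obtain ⟨q', rfl⟩ := dvd_of_dvd_of_dvd (dvd_mul_right c q) h hl
    by_cases hq' : q' = 1
    · exact ⟨1, c, 1, hc, by simp [hq', pow_two]⟩
    · have hlt : q'.length < (c * q').length := by
        have := mt FreeMonoid.length_eq_zero.1 hc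
        rw [FreeMonoid.length_mul]
        omega
      have h' : q' ∣ c * q' := by
        obtain ⟨e, he⟩ := h
        exact ⟨e, mul_left_cancel (a := c) (by rw [he, mul_assoc])⟩
      obtain ⟨β, γ, δ, hγ, e⟩ := exists_square_of_dvd_mul hc q' hq' h'
      exact ⟨c * β, γ, δ, hγ, by rw [mul_assoc, e]; simp only [mul_assoc]⟩
termination_by q.length

/-! ### Coefficients -/

/-- `FA.coeffs` as a linear equivalence. -/
noncomputable def coeffsEquiv : FA k ≃ₗ[ZMod 2] (FreeMonoid (Fin k) →₀ ZMod 2) :=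
  FreeAlgebra.equivMonoidAlgebraFreeMonoid.toLinearEquiv.trans
    (MonoidAlgebra.coeffLinearEquiv (ZMod 2))

theorem coeffs_zero : coeffs (0 : FA k) = 0 := map_zero coeffsEquiv

theorem coeffs_add (p q : FA k) : coeffs (p + q) = coeffs p + coeffs q := map_add coeffsEquiv p q

theorem coeffs_sub (p q : FA k) : coeffs (p - q) = coeffs p - coeffs q := map_sub coeffsEquiv p q

theorem coeffs_smul (c : ZMod 2) (p : FA k) : coeffs (c • p) = c • coeffs p :=
  map_smul coeffsEquiv c p

theorem coeffs_sum {ι : Type*} (s : Finset ι) (f : ι → FA k) :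
    coeffs (∑ i ∈ s, f i) = ∑ i ∈ s, coeffs (f i) := map_sum coeffsEquiv f s

theorem coeffs_injective : Function.Injective (coeffs : FA k → _) := coeffsEquiv.injective

theorem coeffs_monomial (w : FreeMonoid (Fin k)) :
    coeffs (monomial w) = Finsupp.single w 1 := by
  have h : FreeAlgebra.equivMonoidAlgebraFreeMonoid (monomial w) =
      MonoidAlgebra.of (ZMod 2) (FreeMonoid (Fin k)) w := by
    induction w using FreeMonoid.inductionOn' with
    | one => simp [monomial, MonoidAlgebra.one_def]
    | of_mul x w ih =>
      rw [map_mul, ← ih]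
      simp [monomial, FreeAlgebra.equivMonoidAlgebraFreeMonoid]
  rw [coeffs, h]
  simp

theorem eq_sum_monomial (p : FA k) :
    p = ∑ w ∈ (coeffs p).support, coeffs p w • monomial w := by
  apply coeffs_injective
  simp only [coeffs_sum, coeffs_smul, coeffs_monomial, Finsupp.smul_single, smul_eq_mul, mul_one]
  exact (Finsupp.sum_single (coeffs p)).symm

theorem zmod_two_eq_one {c : ZMod 2} (hc : c ≠ 0) : c = 1 := by
  revert c
  decide

/-- Over the field with two elements, every element is the sum of the monomials occurring in it. -/
theorem induction_on_monomials {P : FA k → Prop} (p : FA k) (zero : P 0)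
    (add : ∀ p q, P p → P q → P (p + q)) (mono : ∀ w, coeffs p w ≠ 0 → P (monomial w)) : P p := by
  rw [eq_sum_monomial p]
  refine Finset.sum_induction _ P add zero fun w hw => ?_
  rw [Finsupp.mem_support_iff] at hw
  rw [zmod_two_eq_one hw, one_smul]
  exact mono w hw

theorem coeffs_mul (p q : FA k) :
    coeffs (p * q) = (FreeAlgebra.equivMonoidAlgebraFreeMonoid p *
      FreeAlgebra.equivMonoidAlgebraFreeMonoid q).coeff := by
  rw [coeffs, map_mul]

theorem exists_of_coeffs_mul_ne_zero {p q : FA k} {w : FreeMonoid (Fin k)}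
    (h : coeffs (p * q) w ≠ 0) :
    ∃ a b, coeffs p a ≠ 0 ∧ coeffs q b ≠ 0 ∧ a * b = w := by
  classical
  rw [coeffs_mul, ← Finsupp.mem_support_iff] at h
  obtain ⟨a, ha, b, hb, rfl⟩ := Finset.mem_mul.1 (MonoidAlgebra.support_coeff_mul_subset _ _ h)
  exact ⟨a, b, Finsupp.mem_support_iff.1 ha, Finsupp.mem_support_iff.1 hb, rfl⟩

/-! ### Top words -/

/-- A word of maximal length among the words occurring in `p`. -/
def IsTopWord (p : FA k) (w : FreeMonoid (Fin k)) : Prop :=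
  coeffs p w ≠ 0 ∧ ∀ w', coeffs p w' ≠ 0 → w'.length ≤ w.length

theorem IsTopWord.length_eq {p : FA k} {w : FreeMonoid (Fin k)} (h : IsTopWord p w) :
    w.length = degree p :=
  le_antisymm (Finset.le_sup (f := FreeMonoid.length) (Finsupp.mem_support_iff.2 h.1))
    (Finset.sup_le fun w' hw' => h.2 w' (Finsupp.mem_support_iff.1 hw'))

theorem isTopWord_of_length_eq {p : FA k} {w : FreeMonoid (Fin k)} (h : coeffs p w ≠ 0)
    (hl : w.length = degree p) : IsTopWord p w :=
  ⟨h, fun _ hw' => hl ▸ Finset.le_sup (f := FreeMonoid.length) (Finsupp.mem_support_iff.2 hw')⟩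

theorem exists_isTopWord {p : FA k} (hp : p ≠ 0) : ∃ w, IsTopWord p w := by
  have hne : (coeffs p).support.Nonempty := by
    rw [Finsupp.support_nonempty_iff]
    exact fun h => hp (coeffs_injective (h.trans coeffs_zero.symm))
  obtain ⟨w, hw, h⟩ := Finset.exists_max_image _ FreeMonoid.length hne
  exact ⟨w, Finsupp.mem_support_iff.1 hw, fun w' hw' => h w' (Finsupp.mem_support_iff.2 hw')⟩

theorem IsTopWord.ne_zero {p : FA k} {w : FreeMonoid (Fin k)} (h : IsTopWord p w) : p ≠ 0 := by
  rintro rfl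
  exact h.1 (by rw [coeffs_zero]; rfl)

theorem IsTopWord.mul {p q : FA k} {a b : FreeMonoid (Fin k)} (ha : IsTopWord p a)
    (hb : IsTopWord q b) : IsTopWord (p * q) (a * b) := by
  constructor
  · rw [coeffs_mul]
    -- By maximality of the lengths, `a * b` factors in only one way into words of `p` and of `q`.
    rw [MonoidAlgebra.coeff_mul_mul_of_uniqueMul]
    · exact mul_ne_zero ha.1 hb.1
    · intro a' b' ha' hb' h
      have hla := ha.2 a' (Finsupp.mem_support_iff.1 ha')
      have hlb := hb.2 b' (Finsupp.mem_support_iff.1 hb')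
      have hl := congrArg FreeMonoid.length h
      simp only [FreeMonoid.length_mul] at hl
      exact List.append_inj h (show a'.length = a.length by omega)
  · intro w hw
    obtain ⟨a', b', ha', hb', rfl⟩ := exists_of_coeffs_mul_ne_zero hw
    simpa only [FreeMonoid.length_mul] using add_le_add (ha.2 a' ha') (hb.2 b' hb')

theorem IsTopWord.exists_of_mul {p q : FA k} {w : FreeMonoid (Fin k)} (h : IsTopWord (p * q) w) :
    ∃ a b, IsTopWord p a ∧ IsTopWord q b ∧ w = a * b := by
  obtain ⟨a, b, ha, hb, rfl⟩ := exists_of_coeffs_mul_ne_zero h.1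
  obtain ⟨a₀, ha₀⟩ := exists_isTopWord (left_ne_zero_of_mul h.ne_zero)
  obtain ⟨b₀, hb₀⟩ := exists_isTopWord (right_ne_zero_of_mul h.ne_zero)
  have hl := h.2 _ (ha₀.mul hb₀).1
  have hla := ha₀.2 a ha
  have hlb := hb₀.2 b hb
  simp only [FreeMonoid.length_mul] at hl
  exact ⟨a, b, ⟨ha, fun w' hw' => (ha₀.2 w' hw').trans (by omega)⟩,
    ⟨hb, fun w' hw' => (hb₀.2 w' hw').trans (by omega)⟩, rfl⟩

/-- The word `b` is the only top word of `p`. -/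
def HasTopWord (p : FA k) (b : FreeMonoid (Fin k)) : Prop :=
  IsTopWord p b ∧ ∀ w, IsTopWord p w → w = b

theorem coeffs_homogeneousPart (n : ℕ) (p : FA k) (w : FreeMonoid (Fin k)) :
    coeffs (homogeneousPart n p) w = if w.length = n then coeffs p w else 0 := by
  classical
  simp only [homogeneousPart, coeffs_sum, coeffs_smul, coeffs_monomial, Finsupp.smul_single,
    smul_eq_mul, mul_one, Finsupp.finsetSum_apply, Finsupp.single_apply, Finset.sum_ite_eq',
    Finset.mem_filter, Finsupp.mem_support_iff]
  by_cases h : coeffs p w = 0 <;> simp [h]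

theorem HasAperiodicMonomialTop.exists_hasTopWord {p : FA k} (h : HasAperiodicMonomialTop p) :
    ∃ b, HasTopWord p b ∧ Aperiodic b := by
  obtain ⟨b, hb, hb'⟩ := h
  have key : ∀ w, (if w.length = degree p then coeffs p w else 0) =
      Finsupp.single b (1 : ZMod 2) w := by
    intro w
    rw [← coeffs_homogeneousPart, ← coeffs_monomial, ← hb, topPart]
  refine ⟨b, ⟨?_, fun w hw => ?_⟩, hb'⟩
  · have := key b
    rw [Finsupp.single_eq_same] at this
    split_ifs at this with hl
    · exact isTopWord_of_length_eq (by rw [this]; exact one_ne_zero) hl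
    · exact absurd this zero_ne_one
  · by_contra hne
    have := key w
    rw [if_pos hw.length_eq, Finsupp.single_eq_of_ne hne] at this
    exact hw.1 this

/-! ### Left division -/

/-- Left division with remainder by an element with a single top word `b`: the remainder contains
no word that begins with `b`. -/
theorem exists_eq_mul_add {v : FA k} {b : FreeMonoid (Fin k)} (hv : HasTopWord v b) (p : FA k) :
    ∃ s r, p = v * s + r ∧ ∀ w, b ∣ w → coeffs r w = 0 := by
  let P : FA k → Prop := fun p => ∃ s r, p = v * s + r ∧ ∀ w, b ∣ w → coeffs r w = 0
  have zero : P 0 := ⟨0, 0, by simp, fun w _ => by rw [coeffs_zero]; rfl⟩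
  have add : ∀ p q, P p → P q → P (p + q) := by
    rintro p q ⟨s, r, rfl, hr⟩ ⟨s', r', rfl, hr'⟩
    refine ⟨s + s', r + r', by rw [mul_add]; abel, fun w hw => ?_⟩
    rw [coeffs_add, Finsupp.add_apply, hr w hw, hr' w hw, add_zero]
  have mono : ∀ n, ∀ w : FreeMonoid (Fin k), w.length = n → P (monomial w) := by
    intro n
    induction n using Nat.strong_induction_on with
    | _ n ih =>
      intro w hw
      by_cases hbw : b ∣ w
      · obtain ⟨c, rfl⟩ := hbw
        -- The words of `b c - v c` are shorter than `b c`.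
        have hP : P (monomial (b * c) - v * monomial c) := by
          refine induction_on_monomials _ zero add fun w' hw' => ih _ ?_ w' rfl
          rw [coeffs_sub, Finsupp.sub_apply, coeffs_monomial] at hw'
          have hc : HasTopWord (monomial c) c := by
            have : ∀ w, coeffs (monomial c) w ≠ 0 → w = c := fun w hw => by
              by_contra hne
              rw [coeffs_monomial, Finsupp.single_eq_of_ne hne] at hw
              exact hw rfl
            refine ⟨⟨by simp [coeffs_monomial], fun w hw => by rw [this w hw]⟩,
              fun w hw => this w hw.1⟩
          have htop := hv.1.mul hc.1
          by_cases hne : w' = b * c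
          · rw [hne, Finsupp.single_eq_same, zmod_two_eq_one htop.1, sub_self] at hw'
            exact absurd rfl hw'
          · rw [Finsupp.single_eq_of_ne hne, zero_sub, neg_ne_zero] at hw'
            rw [← hw]
            refine lt_of_le_of_ne (htop.2 w' hw') fun hl => hne ?_
            obtain ⟨b', c', hb', hc', e⟩ := IsTopWord.exists_of_mul (w := w')
              ⟨hw', fun x hx => hl ▸ htop.2 x hx⟩
            rw [e, hv.2 b' hb', hc.2 c' hc']
        obtain ⟨s, r, e, hr⟩ := hP
        exact ⟨s + monomial c, r, by rw [sub_eq_iff_eq_add.1 e, mul_add]; abel, hr⟩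
      · refine ⟨0, monomial w, by simp, fun w' hw' => ?_⟩
        rw [coeffs_monomial, Finsupp.single_eq_of_ne]
        rintro rfl
        exact hbw hw'
  exact induction_on_monomials p zero add fun w _ => mono _ w rfl

/-- The heart of the argument: a solution `x` of degree at least `deg v` of `u x y = v x z`, where
the top word of `u` has no periodicity and is longer than that of `v`, makes `v` a left divisor of
`u`. Nothing is asked of the top words of `y`. -/
theorem exists_eq_mul_of_equation {u v x y z : FA k} {a b : FreeMonoid (Fin k)}
    (hu : HasTopWord u a) (ha : Aperiodic a) (hv : HasTopWord v b)
    (hlt : b.length < a.length) (hx : x ≠ 0) (hxl : b.length ≤ degree x) (hy : y ≠ 0)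
    (h : u * x * y = v * x * z) : ∃ s, u = v * s := by
  obtain ⟨s, r, hsr, hr⟩ := exists_eq_mul_add hv u
  by_cases hr0 : r = 0
  · exact ⟨s, by rw [hsr, hr0, add_zero]⟩
  exfalso
  obtain ⟨y₀, hy₀⟩ := exists_isTopWord hy
  obtain ⟨x₀, hx₀⟩ := exists_isTopWord hx
  have hz : z ≠ 0 := by
    rintro rfl
    rw [mul_zero] at h
    exact mul_ne_zero (mul_ne_zero hu.1.ne_zero hx) hy h
  obtain ⟨z₀, hz₀⟩ := exists_isTopWord hz
  have hba : b ∣ a := by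
    have ht := (hu.1.mul hx₀).mul hy₀
    rw [h] at ht
    obtain ⟨vx, z', hvx, -, e⟩ := ht.exists_of_mul
    obtain ⟨b', x', hb', -, rfl⟩ := hvx.exists_of_mul
    rw [hv.2 b' hb', mul_assoc, mul_assoc] at e
    exact dvd_of_mul_eq_mul e.symm hlt.le
  obtain ⟨c, rfl⟩ := hba
  have hc : c ≠ 1 := by
    rintro rfl
    rw [mul_one] at hlt
    exact lt_irrefl _ hlt
  obtain ⟨R, hR⟩ := exists_isTopWord hr0
  have hrx : r * x * y = v * (x * z - s * x * y) := by
    have hr' : r = u - v * s := by rw [hsr]; abel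
    rw [hr', sub_mul, sub_mul, h]
    noncomm_ring
  have hb_dvd : ∀ w, IsTopWord x w → b ∣ R * (w * y₀) := by
    intro w hw
    have ht := (hR.mul hw).mul hy₀
    rw [hrx] at ht
    obtain ⟨b', d, hb', -, e⟩ := ht.exists_of_mul
    exact ⟨d, by rw [← hv.2 b' hb', ← e, mul_assoc]⟩
  -- A longer `R` would begin with `b`, and no word of the remainder does.
  have hRb : R.length < b.length := by
    by_contra hle
    exact hR.1 (hr R (dvd_of_dvd_of_dvd (hb_dvd x₀ hx₀) (dvd_mul_right _ _) (not_lt.1 hle)))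
  obtain ⟨q, rfl⟩ := dvd_of_dvd_of_dvd (dvd_mul_right _ _) (hb_dvd x₀ hx₀) hRb.le
  have hq : q ≠ 1 := by
    rintro rfl
    rw [mul_one] at hRb
    exact lt_irrefl _ hRb
  have hq_dvd : ∀ w, IsTopWord x w → q ∣ w := by
    intro w hw
    obtain ⟨d, hd⟩ := hb_dvd w hw
    rw [mul_assoc] at hd
    refine dvd_of_mul_eq_mul (mul_left_cancel hd).symm ?_
    rw [hw.length_eq]
    rw [FreeMonoid.length_mul] at hxl
    omega
  -- Cancelling `b` from top words gives `c x' y' = x₀ z₀` with top words `x'`, `x₀` of `x`, and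
  -- both of these begin with `q`.
  have hqcq : q ∣ c * q := by
    have ht := (hv.1.mul hx₀).mul hz₀
    rw [← h] at ht
    obtain ⟨ux, y', hux, -, e⟩ := ht.exists_of_mul
    obtain ⟨a', x', ha', hx', rfl⟩ := hux.exists_of_mul
    rw [hu.2 a' ha'] at e
    simp only [mul_assoc] at e
    have e := mul_left_cancel (mul_left_cancel e)
    obtain ⟨d, hd⟩ := hq_dvd x' hx'
    obtain ⟨d', hd'⟩ := hq_dvd x₀ hx₀
    rw [hd, hd'] at e
    refine dvd_of_mul_eq_mul (b := d' * z₀) (d := d * y') ?_ ?_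
    · simpa only [mul_assoc] using e
    · rw [FreeMonoid.length_mul]
      omega
  obtain ⟨β, γ, δ, hγ, e⟩ := exists_square_of_dvd_mul hc q hq hqcq
  exact hγ (ha (R * β) γ δ (by rw [mul_assoc, e]; simp only [mul_assoc]))

/-! ### Reversal of words -/

theorem star_monomial (w : FreeMonoid (Fin k)) : star (monomial w) = monomial (star w) := by
  induction w using FreeMonoid.inductionOn' with
  | one => simp [monomial]
  | of_mul x w ih =>
    rw [star_mul, FreeMonoid.star_of]
    simp only [monomial, map_mul, star_mul, FreeMonoid.lift_eval_of, FreeAlgebra.star_ι] at ih ⊢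
    rw [ih]

theorem coeffs_star (p : FA k) (w : FreeMonoid (Fin k)) :
    coeffs (star p) w = coeffs p (star w) := by
  classical
  refine induction_on_monomials (P := fun p => coeffs (star p) w = coeffs p (star w)) p ?_ ?_ ?_
  · simp [coeffs_zero]
  · intro p q hp hq
    rw [star_add, coeffs_add, coeffs_add, Finsupp.add_apply, Finsupp.add_apply, hp, hq]
  · intro w' _
    rw [star_monomial, coeffs_monomial, coeffs_monomial, Finsupp.single_apply,
      Finsupp.single_apply]
    exact if_congr ⟨fun h => by rw [← h, star_star], fun h => by rw [h, star_star]⟩ rfl rfl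

theorem length_star (w : FreeMonoid (Fin k)) : (star w).length = w.length :=
  List.length_reverse

theorem IsTopWord.star {p : FA k} {w : FreeMonoid (Fin k)} (h : IsTopWord p w) :
    IsTopWord (star p) (star w) := by
  refine ⟨by rw [coeffs_star, star_star]; exact h.1, fun w' hw' => ?_⟩
  rw [coeffs_star] at hw'
  simpa only [length_star] using h.2 _ hw'

theorem HasTopWord.star {p : FA k} {b : FreeMonoid (Fin k)} (h : HasTopWord p b) :
    HasTopWord (star p) (star b) := by
  refine ⟨h.1.star, fun w hw => ?_⟩
  have := h.2 _ (by simpa only [star_star] using hw.star)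
  rw [← this, star_star]

theorem Aperiodic.star {w : FreeMonoid (Fin k)} (h : Aperiodic w) : Aperiodic (star w) := by
  intro β α γ e
  have := h (Star.star γ) (Star.star α) (Star.star β)
    (by rw [← star_star w, e]; simp only [star_mul, star_pow, mul_assoc])
  rw [← star_star α, this, star_one]

end FA

theorem theorem4p4 (k : ℕ) (u₁ u₂ v₁ v₂ : FA k)
    (hu₁ : FA.HasAperiodicMonomialTop u₁) (hu₂ : FA.HasAperiodicMonomialTop u₂)
    (hv₁ : FA.HasAperiodicMonomialTop v₁) (hv₂ : FA.HasAperiodicMonomialTop v₂)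
    (hdeg : FA.degree v₁ < FA.degree u₁)
    (hsol : ∃ x₁ : FA k, u₁ * x₁ * u₂ = v₁ * x₁ * v₂ ∧
      2 * (FA.degree u₁ + FA.degree v₂) ^ 2 < FA.degree x₁) :
    ∃ s t : FA k, u₁ = v₁ * s ∧ v₂ = t * u₂ ∧
      ∀ x : FA k, u₁ * x * u₂ = v₁ * x * v₂ ↔ s * x = x * t := by
  obtain ⟨a₁, ha₁, hap₁⟩ := hu₁.exists_hasTopWord
  obtain ⟨a₂, ha₂, -⟩ := hu₂.exists_hasTopWord
  obtain ⟨b₁, hb₁, -⟩ := hv₁.exists_hasTopWord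
  obtain ⟨b₂, hb₂, hbp₂⟩ := hv₂.exists_hasTopWord
  obtain ⟨x, hx, hxd⟩ := hsol
  have hx0 : x ≠ 0 := by
    rintro rfl
    simp [FA.degree, FA.coeffs_zero] at hxd
  obtain ⟨w, hw⟩ := FA.exists_isTopWord hx0
  -- The two sides of the equation have the same degree.
  have hlen : a₁.length + w.length + a₂.length = b₁.length + w.length + b₂.length := by
    have h₁ := ((ha₁.1.mul hw).mul ha₂.1).length_eq
    have h₂ := ((hb₁.1.mul hw).mul hb₂.1).length_eq
    rw [hx, ← h₂] at h₁
    simpa only [FreeMonoid.length_mul] using h₁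
  rw [← ha₁.1.length_eq, ← hb₂.1.length_eq, ← hw.length_eq] at hxd
  rw [← ha₁.1.length_eq, ← hb₁.1.length_eq] at hdeg
  have hbig : a₁.length + b₂.length ≤ w.length := by nlinarith
  obtain ⟨s, hs⟩ := FA.exists_eq_mul_of_equation ha₁ hap₁ hb₁ hdeg hx0
    (by rw [← hw.length_eq]; omega) ha₂.1.ne_zero hx
  obtain ⟨t', ht'⟩ := FA.exists_eq_mul_of_equation (x := star x) (y := star v₁) (z := star u₁)
    hb₂.star hbp₂.star ha₂.star (by rw [FA.length_star, FA.length_star]; omega)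
    (star_ne_zero.2 hx0) (by rw [← hw.star.length_eq, FA.length_star, FA.length_star]; omega)
    (star_ne_zero.2 hb₁.1.ne_zero)
    (by simpa only [star_mul, mul_assoc] using congrArg star hx.symm)
  have ht : v₂ = star t' * u₂ := by rw [← star_star v₂, ht', star_mul, star_star]
  refine ⟨s, star t', hs, ht, fun y => ?_⟩
  have e₁ : u₁ * y * u₂ = v₁ * (s * y * u₂) := by rw [hs]; simp only [mul_assoc]
  have e₂ : v₁ * y * v₂ = v₁ * (y * star t' * u₂) := by rw [ht]; simp only [mul_assoc]
  rw [e₁, e₂, mul_right_inj' hb₁.1.ne_zero, mul_left_inj' ha₂.1.ne_zero]
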